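/- Let $\mathbb K$ be a field, let $G$ be a finite simple graph with vertices $x_1,\dots,x_n$, and let $G'$ be the graph obtained from $G$ by attaching a whisker at every vertex, that is, by adding new vertices $y_1,\dots,y_n$ and the edges $\{x_i,y_i\}$ for $1\le i\le n$. Let $R=\mathbb K[x_1,\dots,x_n,y_1,\dots,y_n]$ with its standard grading, and let $$NI(G')=\Big\langle \prod_{v\in N_{G'}[w]} v \;:\; w\in V(G')\Big\rangle\subseteq R$$ be the closed neighborhood ideal of $G'$, where $N_{G'}[w]$ consists of $w$ and its neighbors. Let $\beta_{i,j}$ be the graded Betti numbers of $R/NI(G')$, that is, $F_i=\bigoplus_j R(-j)^{\beta_{i,j}}$ in its graded minimal free resolution, and put $\mathrm{pd}(R/NI(G'))=\max\{i:\beta_{i,j}\ne 0\text{ for some }j\}$ and $\mathrm{reg}(R/NI(G'))=\max\{j-i:\beta_{i,j}\neq 0\}$. Let $a_{G'}$ be the matching number of $G'$, the maximum number of pairwise disjoint edges. Then $$\mathrm{reg}(R/NI(G'))=a_{G'}\quad\text{and}\quad \mathrm{pd}(R/NI(G'))=a_{G'}.$$ Moreover, $NI(G')=\langle x_1y_1,\dots,x_ny_n\rangle$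 and $a_{G'}=n$, so both invariants are equal to $n$. -/

import Mathlib

open MvPolynomial

namespace SimpleGraph

/-- The graph obtained from `G` by attaching a whisker at every vertex: the vertex `Sum.inl v` is
the old vertex `v`, and `Sum.inr v` is the new leaf, which is joined to `Sum.inl v` only. -/
def whiskered {V : Type*} (G : SimpleGraph V) : SimpleGraph (V ⊕ V) where
  Adj
    | Sum.inl u, Sum.inl v => G.Adj u v
    | Sum.inl u, Sum.inr v => u = v
    | Sum.inr u, Sum.inl v => u = v
    | Sum.inr _, Sum.inr _ => False
  symm := ⟨by
    rintro (u | u) (v | v) h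
    · exact G.adj_symm h
    · exact Eq.symm h
    · exact Eq.symm h
    · exact h⟩
  loopless := ⟨by
    rintro (u | u) h
    · exact G.irrefl h
    · exact h⟩

/-- The matching number of a finite graph: the maximum number of edges of a matching. -/
noncomputable def matchingNumber {V : Type*} (G : SimpleGraph V) : ℕ :=
  sSup {k | ∃ M : G.Subgraph, M.IsMatching ∧ M.edgeSet.ncard = k}

/-- The monomial `∏ x_v`, where `v` runs over the closed neighbourhood `N[w] = N(w) ∪ {w}`. -/
noncomputable def closedNbhdMonomial {V : Type*} [Finite V] (K : Type*) [Field K]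
    (G : SimpleGraph V) (w : V) : MvPolynomial V K :=
  ∏ v ∈ (insert w (G.neighborSet w)).toFinite.toFinset, X v

/-- The closed neighbourhood ideal `NI(G)`, generated by the monomials of all closed
neighbourhoods. -/
noncomputable def closedNbhdIdeal {V : Type*} [Finite V] (K : Type*) [Field K]
    (G : SimpleGraph V) : Ideal (MvPolynomial V K) :=
  Ideal.span (Set.range (G.closedNbhdMonomial K))

end SimpleGraph

/-- In the graded free module `⨁ₐ R(-δ a)` over a polynomial ring `R`, whose basis vector with
index `a` has degree `δ a`, the vector `v` is homogeneous of degree `k`. -/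
def IsHomogeneousVector {σ K : Type*} [Field K] {r : ℕ} (δ : Fin r → ℕ) (k : ℕ)
    (v : Fin r → MvPolynomial σ K) : Prop :=
  ∀ a, ∀ m ∈ (v a).support, m.degree + δ a = k

/-- A graded minimal free resolution
`⋯ → F 2 → F 1 → F 0 → R ⧸ I → 0` of `R ⧸ I`, where `R` is a polynomial ring over a field with its
standard grading. Here `F i = ⨁ₐ R(-deg i a)`, the sum being over `a : Fin (rank i)`; the maps are
homogeneous of degree zero, and `F (i + 1)` is mapped into `𝔪 F i`, where `𝔪` is the ideal
generated by the variables. -/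
structure MinimalGradedFreeResolution {σ K : Type*} [Field K] (I : Ideal (MvPolynomial σ K)) where
  rank : ℕ → ℕ
  deg : ∀ i, Fin (rank i) → ℕ
  d : ∀ i, (Fin (rank (i + 1)) → MvPolynomial σ K) →ₗ[MvPolynomial σ K]
    (Fin (rank i) → MvPolynomial σ K)
  aug : (Fin (rank 0) → MvPolynomial σ K) →ₗ[MvPolynomial σ K] (MvPolynomial σ K ⧸ I)
  d_homogeneous : ∀ i b, IsHomogeneousVector (deg i) (deg (i + 1) b) (d i (Pi.single b 1))
  aug_homogeneous : ∀ b, ∃ p : MvPolynomial σ K,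
    p.IsHomogeneous (deg 0 b) ∧ aug (Pi.single b 1) = Ideal.Quotient.mk I p
  aug_surjective : Function.Surjective aug
  exact_zero : Function.Exact (d 0) aug
  exact_succ : ∀ i, Function.Exact (d (i + 1)) (d i)
  minimal : ∀ i v a, d i v a ∈ Ideal.span (Set.range (X : σ → MvPolynomial σ K))

namespace MinimalGradedFreeResolution

/-- The graded Betti number `β_{i,j}`: the number of summands `R(-j)` of `F i`. -/
def betti {σ K : Type*} [Field K] {I : Ideal (MvPolynomial σ K)}
    (F : MinimalGradedFreeResolution I) (i j : ℕ) : ℕ :=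
  (Finset.univ.filter fun a => F.deg i a = j).card

end MinimalGradedFreeResolution

/-- `pd (R ⧸ I) = p`, that is, `p = max {i : β_{i,j}(R ⧸ I) ≠ 0 for some j}`: the quotient has a
graded minimal free resolution, and the Betti numbers of each such resolution give this maximum. -/
def HasProjDim {σ K : Type*} [Field K] (I : Ideal (MvPolynomial σ K)) (p : ℕ) : Prop :=
  Nonempty (MinimalGradedFreeResolution I) ∧
    ∀ F : MinimalGradedFreeResolution I, IsGreatest {i : ℕ | ∃ j, F.betti i j ≠ 0} p

/-- `reg (R ⧸ I) = r`, that is, `r = max {j - i : β_{i,j}(R ⧸ I) ≠ 0}`: the quotient has a graded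
minimal free resolution, and the Betti numbers of each such resolution give this maximum. -/
def HasRegularity {σ K : Type*} [Field K] (I : Ideal (MvPolynomial σ K)) (r : ℤ) : Prop :=
  Nonempty (MinimalGradedFreeResolution I) ∧
    ∀ F : MinimalGradedFreeResolution I,
      IsGreatest {z : ℤ | ∃ i j : ℕ, F.betti i j ≠ 0 ∧ z = (j : ℤ) - (i : ℤ)} r

/-!
The ideal `NI(G')` is generated by the products `x_v y_v`: the closed neighbourhood of the leaf
`y_v` is `{x_v, y_v}`, and it is contained in that of `x_v`. These monomials are pairwise coprime,
so they form a regular sequence of quadrics.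

If `f` is a form of degree `e > 0` and a nonzerodivisor on `R ⧸ I`, the mapping cone of
multiplication by `f` on the minimal resolution of `R ⧸ I` is a minimal resolution of
`R ⧸ (I + (f))`. It raises the projective dimension by `1` and the regularity by `e - 1`, so `n`
quadrics bring both to `n`. The Betti numbers do not depend on the resolution: two comparison maps
compose to a map homotopic to the identity, and since the differentials vanish modulo the variables
they become mutually inverse over `K`.

The whiskers form a perfect matching of the `2 n` vertices of `G'`, hence its matching number is
`n`.
-/

section LinearAlgebra

theorem card_filter_eq_le_of_matrix_mul_eq_one {m n ι S : Type*} [Fintype m] [Fintype n]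
    [DecidableEq n] [DecidableEq ι] [CommRing S] [Nontrivial S]
    {B : Matrix n m S} {A : Matrix m n S} (hBA : B * A = 1) {δ : n → ι} {ε : m → ι}
    (hA : ∀ a b, A a b ≠ 0 → ε a = δ b) (j : ι) :
    (Finset.univ.filter fun b => δ b = j).card ≤ (Finset.univ.filter fun a => ε a = j).card := by
  have hzero : A.toBlock (fun a => ¬ε a = j) (fun b => δ b = j) = 0 := by
    ext a b
    by_contra h
    exact a.2 ((hA a b h).trans b.2)
  have hblock : B.toBlock (fun b => δ b = j) (fun a => ε a = j) *
      A.toBlock (fun a => ε a = j) (fun b => δ b = j) = 1 := by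
    rw [← Matrix.toBlock_one_self, ← hBA, Matrix.toBlock_mul_eq_add _ (fun a => ε a = j), hzero,
      Matrix.mul_zero, add_zero]
  calc (Finset.univ.filter fun b => δ b = j).card
      = (1 : Matrix {b // δ b = j} {b // δ b = j} S).rank := by
        rw [Matrix.rank_one, Fintype.card_subtype]
    _ ≤ (A.toBlock (fun a => ε a = j) (fun b => δ b = j)).rank :=
        hblock ▸ Matrix.rank_mul_le_right _ _
    _ ≤ Fintype.card {a // ε a = j} := Matrix.rank_le_card_height _
    _ = (Finset.univ.filter fun a => ε a = j).card := Fintype.card_subtype _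

theorem exists_linearMap_comp_eq {R P M N : Type*} [Semiring R] [AddCommMonoid P] [AddCommMonoid M]
    [AddCommMonoid N] [Module R P] [Module R M] [Module R N] [Module.Projective R P]
    {f : P →ₗ[R] M} {g : N →ₗ[R] M} (h : ∀ v, f v ∈ LinearMap.range g) :
    ∃ φ : P →ₗ[R] N, g ∘ₗ φ = f := by
  obtain ⟨φ, hφ⟩ := Module.projective_lifting_property g.rangeRestrict (f.codRestrict _ h)
    g.surjective_rangeRestrict
  exact ⟨φ, LinearMap.ext fun v => congrArg Subtype.val (LinearMap.congr_fun hφ v)⟩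

end LinearAlgebra

theorem exists_seq_of_forall_exists_succ {α : ℕ → Type*} {p : ∀ i, α i → Prop}
    {r : ∀ i, α i → α (i + 1) → Prop} {a : α 0} (ha : p 0 a)
    (h : ∀ i x, p i x → ∃ y, p (i + 1) y ∧ r i x y) :
    ∃ u : ∀ i, α i, u 0 = a ∧ (∀ i, p i (u i)) ∧ ∀ i, r i (u i) (u (i + 1)) := by
  choose next hnext hr using h
  let u : ∀ i, {x : α i // p i x} :=
    Nat.rec ⟨a, ha⟩ fun i x => ⟨next i x x.2, hnext i x x.2⟩
  exact ⟨fun i => (u i).1, rfl, fun i => (u i).2, fun i => hr i (u i).1 (u i).2⟩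

theorem factor_sup_span_singleton_eq_zero_iff {R : Type*} [CommRing R] {I : Ideal R} {f : R}
    {x : R ⧸ I} :
    Submodule.factor (le_sup_left : I ≤ I ⊔ Ideal.span {f}) x = 0 ↔ ∃ y, f • y = x := by
  constructor
  · obtain ⟨p, rfl⟩ := Submodule.mkQ_surjective I x
    intro h
    obtain ⟨a, ha, b, hb, rfl⟩ := Submodule.mem_sup.1 ((Submodule.Quotient.mk_eq_zero _).1 h)
    obtain ⟨c, rfl⟩ := Ideal.mem_span_singleton'.1 hb
    refine ⟨I.mkQ c, ?_⟩
    rw [← map_smul, smul_eq_mul, mul_comm, map_add, Submodule.mkQ_apply I a,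
      (Submodule.Quotient.mk_eq_zero _).2 ha, zero_add]
  · rintro ⟨y, rfl⟩
    obtain ⟨p, rfl⟩ := Submodule.mkQ_surjective I y
    exact (Submodule.Quotient.mk_eq_zero _).2
      (Ideal.mem_sup_right (Ideal.mul_mem_right p _ (Ideal.mem_span_singleton_self f)))

section FinAppend

/-- `Fin.append` as a linear equivalence. -/
def finAppendLinearEquiv (R : Type*) [Semiring R] (m n : ℕ) :
    ((Fin m → R) × (Fin n → R)) ≃ₗ[R] (Fin (m + n) → R) where
  __ := Fin.appendEquiv m n
  map_add' p q := by
    ext a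
    refine Fin.addCases (fun a => ?_) (fun a => ?_) a <;> simp [Fin.appendEquiv]
  map_smul' c p := by
    ext a
    refine Fin.addCases (fun a => ?_) (fun a => ?_) a <;> simp [Fin.appendEquiv]

variable {m n : ℕ}

theorem exists_append_eq {α : Type*} (v : Fin (m + n) → α) : ∃ u w, Fin.append u w = v :=
  ⟨_, _, Fin.append_castAdd_natAdd⟩

variable {R : Type*} [Zero R]

theorem append_eq_zero_iff {u : Fin m → R} {w : Fin n → R} :
    Fin.append u w = 0 ↔ u = 0 ∧ w = 0 := by
  constructor
  · intro h
    exact ⟨funext fun a => by simpa using congrFun h (Fin.castAdd n a),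
      funext fun a => by simpa using congrFun h (Fin.natAdd m a)⟩
  · rintro ⟨rfl, rfl⟩
    ext a
    refine Fin.addCases (fun a => ?_) (fun a => ?_) a <;> simp

theorem append_single_zero (b : Fin m) (x : R) :
    Fin.append (Pi.single b x) (0 : Fin n → R) = Pi.single (Fin.castAdd n b) x := by
  ext a
  refine Fin.addCases (fun a => ?_) (fun a => ?_) a
  · simp [Pi.single_apply]
  · have hab : Fin.natAdd m a ≠ Fin.castAdd n b :=
      Fin.ne_of_gt (b.isLt.trans_le (Nat.le_add_right m a))
    simp [hab]

theorem append_zero_single (b : Fin n) (x : R) :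
    Fin.append (0 : Fin m → R) (Pi.single b x) = Pi.single (Fin.natAdd m b) x := by
  ext a
  refine Fin.addCases (fun a => ?_) (fun a => ?_) a
  · have hab : Fin.castAdd n a ≠ Fin.natAdd m b :=
      Fin.ne_of_lt (a.isLt.trans_le (Nat.le_add_right m b))
    simp [hab]
  · simp [Pi.single_apply]

end FinAppend

section GradedMap

variable {σ K : Type*} [Field K] {r s t : ℕ} {δ : Fin r → ℕ} {ε : Fin s → ℕ} {ζ : Fin t → ℕ}

namespace IsHomogeneousVector

variable {k : ℕ} {v w : Fin r → MvPolynomial σ K}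

theorem zero : IsHomogeneousVector δ k (0 : Fin r → MvPolynomial σ K) := by
  intro a m hm
  simp at hm

theorem neg (hv : IsHomogeneousVector δ k v) : IsHomogeneousVector δ k (-v) := by
  intro a m hm
  rw [Pi.neg_apply, support_neg] at hm
  exact hv a m hm

theorem smul {e : ℕ} {f : MvPolynomial σ K} (hf : f.IsHomogeneous e)
    (hv : IsHomogeneousVector δ k v) : IsHomogeneousVector δ (k + e) (f • v) := by
  classical
  intro a m hm
  obtain ⟨p, hp, q, hq, rfl⟩ := Finset.mem_add.1 (support_mul _ _ hm)
  have hpe : p.degree = e := hf.degree_eq_sum_deg_support hp |>.symm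
  rw [map_add, hpe, ← hv a q hq]
  ring

theorem single (b : Fin r) : IsHomogeneousVector δ (δ b) (Pi.single b (1 : MvPolynomial σ K)) := by
  intro a m hm
  obtain rfl | hab := eq_or_ne a b
  · rw [Pi.single_eq_same, support_one, Finset.mem_singleton] at hm
    simp [hm]
  · simp [hab] at hm

theorem append {u : Fin s → MvPolynomial σ K} (hv : IsHomogeneousVector δ k v)
    (hu : IsHomogeneousVector ε k u) :
    IsHomogeneousVector (Fin.append δ ε) k (Fin.append v u) := by
  intro a
  refine Fin.addCases (fun a => ?_) (fun a => ?_) a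
  · simpa only [Fin.append_left] using hv a
  · simpa only [Fin.append_right] using hu a

end IsHomogeneousVector

/-- The homogeneous part of degree `k` of a vector in the graded free module `⨁ₐ R(-δ a)`. -/
noncomputable def homogeneousPart (δ : Fin r → ℕ) (k : ℕ) :
    (Fin r → MvPolynomial σ K) →ₗ[K] (Fin r → MvPolynomial σ K) :=
  LinearMap.pi fun a =>
    (if δ a ≤ k then homogeneousComponent (k - δ a) else 0) ∘ₗ LinearMap.proj a

theorem coeff_homogeneousPart (k : ℕ) (v : Fin r → MvPolynomial σ K) (a : Fin r) (m : σ →₀ ℕ) :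
    coeff m (homogeneousPart δ k v a) = if m.degree + δ a = k then coeff m (v a) else 0 := by
  classical
  simp only [homogeneousPart, LinearMap.pi_apply, LinearMap.comp_apply, LinearMap.proj_apply]
  by_cases h : δ a ≤ k
  · rw [if_pos h, coeff_homogeneousComponent]
    exact if_congr (by omega) rfl rfl
  · rw [if_neg h, if_neg (by omega), LinearMap.zero_apply, coeff_zero]

theorem isHomogeneousVector_homogeneousPart (k : ℕ) (v : Fin r → MvPolynomial σ K) :
    IsHomogeneousVector δ k (homogeneousPart δ k v) := by
  intro a m hm
  rw [mem_support_iff, coeff_homogeneousPart] at hm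
  exact of_not_not fun h => hm (if_neg h)

theorem IsHomogeneousVector.homogeneousPart_eq {k : ℕ} {v : Fin r → MvPolynomial σ K}
    (hv : IsHomogeneousVector δ k v) (l : ℕ) :
    homogeneousPart δ l v = if k = l then v else 0 := by
  ext a m
  rw [coeff_homogeneousPart]
  by_cases hm : m ∈ (v a).support
  · rw [hv a m hm]
    split_ifs <;> rfl
  · rw [notMem_support_iff] at hm
    split_ifs <;> simp [hm]

/-- A linear map `⨁ᵦ R(-δ b) → ⨁ₐ R(-ε a)` of graded free modules is homogeneous of degree zero. -/
def IsHomogeneousMap (δ : Fin r → ℕ) (ε : Fin s → ℕ)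
    (f : (Fin r → MvPolynomial σ K) →ₗ[MvPolynomial σ K] (Fin s → MvPolynomial σ K)) : Prop :=
  ∀ b, IsHomogeneousVector ε (δ b) (f (Pi.single b 1))

namespace IsHomogeneousMap

variable {f : (Fin r → MvPolynomial σ K) →ₗ[MvPolynomial σ K] (Fin s → MvPolynomial σ K)}

theorem map_homogeneousPart (hf : IsHomogeneousMap δ ε f) (k : ℕ) (v : Fin r → MvPolynomial σ K) :
    f (homogeneousPart δ k v) = homogeneousPart ε k (f v) := by
  suffices h : f.restrictScalars K ∘ₗ homogeneousPart δ k =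
      homogeneousPart ε k ∘ₗ f.restrictScalars K from LinearMap.congr_fun h v
  refine LinearMap.pi_ext' fun b => MvPolynomial.linearMap_ext fun m => LinearMap.ext fun c => ?_
  have hm : (monomial m c).IsHomogeneous m.degree := isHomogeneous_monomial c rfl
  have hsingle : Pi.single b (monomial m c) =
      monomial m c • (Pi.single b 1 : Fin r → MvPolynomial σ K) := by
    rw [← Pi.single_smul, smul_eq_mul, mul_one]
  simp only [LinearMap.comp_apply, LinearMap.coe_restrictScalars, LinearMap.coe_single]
  rw [hsingle, map_smul f, ((IsHomogeneousVector.single b).smul hm).homogeneousPart_eq,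
    ((hf b).smul hm).homogeneousPart_eq]
  split_ifs
  · rw [map_smul]
  · rw [map_zero]

theorem map_isHomogeneousVector (hf : IsHomogeneousMap δ ε f) {k : ℕ}
    {v : Fin r → MvPolynomial σ K} (hv : IsHomogeneousVector δ k v) :
    IsHomogeneousVector ε k (f v) := by
  have h := hf.map_homogeneousPart k v
  rw [hv.homogeneousPart_eq, if_pos rfl] at h
  exact h ▸ isHomogeneousVector_homogeneousPart k _

theorem comp {g : (Fin s → MvPolynomial σ K) →ₗ[MvPolynomial σ K] (Fin t → MvPolynomial σ K)}
    (hg : IsHomogeneousMap ε ζ g) (hf : IsHomogeneousMap δ ε f) :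
    IsHomogeneousMap δ ζ (g ∘ₗ f) :=
  fun b => hg.map_isHomogeneousVector (hf b)

theorem exists_of_forall_exists {M : Type*} [AddCommGroup M] [Module (MvPolynomial σ K) M]
    {g : (Fin r → MvPolynomial σ K) →ₗ[MvPolynomial σ K] M}
    {h : (Fin s → MvPolynomial σ K) →ₗ[MvPolynomial σ K] M}
    (H : ∀ b, ∃ w, IsHomogeneousVector ε (δ b) w ∧ h w = g (Pi.single b 1)) :
    ∃ φ, IsHomogeneousMap δ ε φ ∧ h ∘ₗ φ = g := by
  choose w hw hhw using H
  let basis := Pi.basisFun (MvPolynomial σ K) (Fin r)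
  have hφ (b) : basis.constr (MvPolynomial σ K) w (Pi.single b 1) = w b := by
    simpa only [basis, Pi.basisFun_apply] using basis.constr_basis (MvPolynomial σ K) w b
  refine ⟨basis.constr (MvPolynomial σ K) w, fun b => (hφ b).symm ▸ hw b, basis.ext fun b => ?_⟩
  rw [Pi.basisFun_apply, LinearMap.comp_apply, hφ, hhw]

theorem exists_comp_eq
    {g : (Fin t → MvPolynomial σ K) →ₗ[MvPolynomial σ K] (Fin s → MvPolynomial σ K)}
    (hf : IsHomogeneousMap δ ε f) (hg : IsHomogeneousMap ζ ε g)
    (h : ∀ v, f v ∈ LinearMap.range g) : ∃ φ, IsHomogeneousMap δ ζ φ ∧ g ∘ₗ φ = f := by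
  refine exists_of_forall_exists fun b => ?_
  obtain ⟨w, hw⟩ := h (Pi.single b 1)
  refine ⟨homogeneousPart ζ (δ b) w, isHomogeneousVector_homogeneousPart _ _, ?_⟩
  rw [hg.map_homogeneousPart, hw, (hf b).homogeneousPart_eq, if_pos rfl]

end IsHomogeneousMap

end GradedMap

section ResidueMatrix

variable {σ K : Type*} [CommRing K] {r s t : ℕ}

/-- The matrix of the map `K ^ r → K ^ s` which a linear map `R ^ r → R ^ s` over the polynomial
ring `R` induces modulo the ideal generated by the variables. -/
noncomputable def residueMatrix
    (f : (Fin r → MvPolynomial σ K) →ₗ[MvPolynomial σ K] (Fin s → MvPolynomial σ K)) :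
    Matrix (Fin s) (Fin r) K :=
  (LinearMap.toMatrix' f).map constantCoeff

theorem residueMatrix_apply
    (f : (Fin r → MvPolynomial σ K) →ₗ[MvPolynomial σ K] (Fin s → MvPolynomial σ K))
    (a : Fin s) (b : Fin r) : residueMatrix f a b = constantCoeff (f (Pi.single b 1) a) := by
  rw [residueMatrix, Matrix.map_apply, LinearMap.toMatrix'_apply]

theorem residueMatrix_id :
    residueMatrix (LinearMap.id : (Fin r → MvPolynomial σ K) →ₗ[MvPolynomial σ K] _) = 1 := by
  rw [residueMatrix, LinearMap.toMatrix'_id, Matrix.map_one _ (map_zero _) (map_one _)]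

theorem residueMatrix_comp
    (g : (Fin s → MvPolynomial σ K) →ₗ[MvPolynomial σ K] (Fin t → MvPolynomial σ K))
    (f : (Fin r → MvPolynomial σ K) →ₗ[MvPolynomial σ K] (Fin s → MvPolynomial σ K)) :
    residueMatrix (g ∘ₗ f) = residueMatrix g * residueMatrix f := by
  rw [residueMatrix, LinearMap.toMatrix'_comp, Matrix.map_mul]
  rfl

theorem residueMatrix_add
    (f g : (Fin r → MvPolynomial σ K) →ₗ[MvPolynomial σ K] (Fin s → MvPolynomial σ K)) :
    residueMatrix (f + g) = residueMatrix f + residueMatrix g := by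
  rw [residueMatrix, map_add, Matrix.map_add _ (map_add _)]
  rfl

theorem residueMatrix_sub
    (f g : (Fin r → MvPolynomial σ K) →ₗ[MvPolynomial σ K] (Fin s → MvPolynomial σ K)) :
    residueMatrix (f - g) = residueMatrix f - residueMatrix g := by
  rw [residueMatrix, map_sub, Matrix.map_sub _ (map_sub _)]
  rfl

theorem mem_idealOfVars_iff_constantCoeff_eq_zero {p : MvPolynomial σ K} :
    p ∈ idealOfVars σ K ↔ constantCoeff p = 0 := by
  rw [← pow_one (idealOfVars σ K), mem_pow_idealOfVars_iff']
  simp [Finsupp.degree_eq_zero_iff, constantCoeff_eq]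

theorem IsHomogeneousMap.deg_eq_of_residueMatrix_ne_zero {K : Type*} [Field K] {δ : Fin r → ℕ}
    {ε : Fin s → ℕ}
    {f : (Fin r → MvPolynomial σ K) →ₗ[MvPolynomial σ K] (Fin s → MvPolynomial σ K)}
    (hf : IsHomogeneousMap δ ε f) {a : Fin s} {b : Fin r} (h : residueMatrix f a b ≠ 0) :
    ε a = δ b := by
  rw [residueMatrix_apply] at h
  simpa using hf b a 0 (mem_support_iff.2 h)

end ResidueMatrix

namespace MinimalGradedFreeResolution

variable {σ K : Type*} [Field K] {I : Ideal (MvPolynomial σ K)}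

section Comparison

theorem residueMatrix_d (F : MinimalGradedFreeResolution I) (i : ℕ) :
    residueMatrix (F.d i) = 0 := by
  ext a b
  rw [residueMatrix_apply, Matrix.zero_apply]
  exact mem_idealOfVars_iff_constantCoeff_eq_zero.1 (F.minimal i _ a)

theorem exists_lift_aug (F : MinimalGradedFreeResolution I) :
    ∃ q : (Fin (F.rank 0) → MvPolynomial σ K) →ₗ[MvPolynomial σ K] (Fin 1 → MvPolynomial σ K),
      IsHomogeneousMap (F.deg 0) (fun _ => 0) q ∧ ∀ v, F.aug v = Ideal.Quotient.mk I (q v 0) := by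
  obtain ⟨q, hq, haug⟩ := IsHomogeneousMap.exists_of_forall_exists (δ := F.deg 0)
    (ε := fun _ : Fin 1 => 0) (g := F.aug) (h := I.mkQ ∘ₗ LinearMap.proj 0) fun b => by
      obtain ⟨p, hp, hpb⟩ := F.aug_homogeneous b
      exact ⟨fun _ => p, fun _ m hm => (hp.degree_eq_sum_deg_support hm).symm, hpb.symm⟩
  exact ⟨q, hq, fun v => (LinearMap.congr_fun haug v).symm⟩

attribute [local instance] MvPolynomial.gradedAlgebra

theorem aug_homogeneousPart (F : MinimalGradedFreeResolution I)
    (hI : I.IsHomogeneous (homogeneousSubmodule σ K)) {v : Fin (F.rank 0) → MvPolynomial σ K}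
    {p : MvPolynomial σ K} (h : F.aug v = Ideal.Quotient.mk I p) (k : ℕ) :
    F.aug (homogeneousPart (F.deg 0) k v) = Ideal.Quotient.mk I (homogeneousComponent k p) := by
  obtain ⟨q, hq, haug⟩ := F.exists_lift_aug
  rw [haug, Ideal.Quotient.eq] at h ⊢
  have hpart : q (homogeneousPart (F.deg 0) k v) 0 = homogeneousComponent k (q v 0) := by
    rw [hq.map_homogeneousPart]
    simp [homogeneousPart]
  rw [hpart, ← map_sub]
  exact (mem_iff_homogeneousComponent_mem hI _).1 h k

/-- A homogeneous chain map of degree zero between two minimal graded free resolutions of `R ⧸ I`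
which lifts the identity of `R ⧸ I`. -/
structure Hom (F G : MinimalGradedFreeResolution I) where
  app : ∀ i, (Fin (F.rank i) → MvPolynomial σ K) →ₗ[MvPolynomial σ K]
    (Fin (G.rank i) → MvPolynomial σ K)
  app_homogeneous : ∀ i, IsHomogeneousMap (F.deg i) (G.deg i) (app i)
  aug_comp_app : G.aug ∘ₗ app 0 = F.aug
  d_comp_app : ∀ i, G.d i ∘ₗ app (i + 1) = app i ∘ₗ F.d i

theorem exists_lift_of_aug (hI : I.IsHomogeneous (homogeneousSubmodule σ K))
    (F G : MinimalGradedFreeResolution I) :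
    ∃ φ, IsHomogeneousMap (F.deg 0) (G.deg 0) φ ∧ G.aug ∘ₗ φ = F.aug := by
  refine IsHomogeneousMap.exists_of_forall_exists fun b => ?_
  obtain ⟨p, hp, hpb⟩ := F.aug_homogeneous b
  obtain ⟨w, hw⟩ := G.aug_surjective (Ideal.Quotient.mk I p)
  refine ⟨homogeneousPart (G.deg 0) (F.deg 0 b) w, isHomogeneousVector_homogeneousPart _ _, ?_⟩
  rw [G.aug_homogeneousPart hI hw, homogeneousComponent_of_mem hp, if_pos rfl, hpb]

theorem nonempty_hom (hI : I.IsHomogeneous (homogeneousSubmodule σ K))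
    (F G : MinimalGradedFreeResolution I) : Nonempty (F.Hom G) := by
  obtain ⟨φ₀, hφ₀, haug⟩ := exists_lift_of_aug hI F G
  obtain ⟨φ, rfl, hφ, hd⟩ := exists_seq_of_forall_exists_succ
    (p := fun i φ => IsHomogeneousMap (F.deg i) (G.deg i) φ ∧
      ∀ v, φ (F.d i v) ∈ LinearMap.range (G.d i))
    (r := fun i φ ψ => G.d i ∘ₗ ψ = φ ∘ₗ F.d i) (a := φ₀)
    ⟨hφ₀, fun v => (G.exact_zero _).1 <| by
      rw [← LinearMap.comp_apply, haug, F.exact_zero.apply_apply_eq_zero]⟩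
    fun i φ ⟨hφ, hrange⟩ => by
      obtain ⟨ψ, hψ, hdψ⟩ := (hφ.comp (F.d_homogeneous i)).exists_comp_eq (G.d_homogeneous i) hrange
      refine ⟨ψ, ⟨hψ, fun v => (G.exact_succ i _).1 ?_⟩, hdψ⟩
      rw [← LinearMap.comp_apply, hdψ, LinearMap.comp_apply, (F.exact_succ i).apply_apply_eq_zero,
        map_zero]
  exact ⟨⟨φ, fun i => (hφ i).1, haug, hd⟩⟩

theorem exists_homotopy (F : MinimalGradedFreeResolution I)
    {θ : ∀ i, (Fin (F.rank i) → MvPolynomial σ K) →ₗ[MvPolynomial σ K]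
      (Fin (F.rank i) → MvPolynomial σ K)}
    (haug : F.aug ∘ₗ θ 0 = 0) (hd : ∀ i, F.d i ∘ₗ θ (i + 1) = θ i ∘ₗ F.d i) :
    ∃ h : ∀ i, (Fin (F.rank i) → MvPolynomial σ K) →ₗ[MvPolynomial σ K]
        (Fin (F.rank (i + 1)) → MvPolynomial σ K),
      F.d 0 ∘ₗ h 0 = θ 0 ∧ ∀ i, F.d (i + 1) ∘ₗ h (i + 1) + h i ∘ₗ F.d i = θ (i + 1) := by
  obtain ⟨h₀, hh₀⟩ := exists_linearMap_comp_eq (f := θ 0) (g := F.d 0) fun v =>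
    (F.exact_zero _).1 (LinearMap.congr_fun haug v)
  obtain ⟨h, rfl, -, hh⟩ := exists_seq_of_forall_exists_succ
    (p := fun i h => F.d i ∘ₗ h ∘ₗ F.d i = θ i ∘ₗ F.d i)
    (r := fun i h h' => F.d (i + 1) ∘ₗ h' + h ∘ₗ F.d i = θ (i + 1)) (a := h₀)
    (by rw [← LinearMap.comp_assoc, hh₀])
    fun i h hp => by
      obtain ⟨h', hh'⟩ := exists_linearMap_comp_eq (f := θ (i + 1) - h ∘ₗ F.d i) (g := F.d (i + 1))
        fun v => (F.exact_succ i _).1 <| by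
          rw [← LinearMap.comp_apply, LinearMap.comp_sub, hd, hp, sub_self, LinearMap.zero_apply]
      refine ⟨h', ?_, by rw [hh', sub_add_cancel]⟩
      rw [← LinearMap.comp_assoc, hh', LinearMap.sub_comp, LinearMap.comp_assoc,
        (F.exact_succ i).linearMap_comp_eq_zero, LinearMap.comp_zero, sub_zero]
  exact ⟨h, hh₀, hh⟩

theorem residueMatrix_eq_zero_of_aug_comp_eq_zero (F : MinimalGradedFreeResolution I)
    {θ : ∀ i, (Fin (F.rank i) → MvPolynomial σ K) →ₗ[MvPolynomial σ K]
      (Fin (F.rank i) → MvPolynomial σ K)}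
    (haug : F.aug ∘ₗ θ 0 = 0) (hd : ∀ i, F.d i ∘ₗ θ (i + 1) = θ i ∘ₗ F.d i) (i : ℕ) :
    residueMatrix (θ i) = 0 := by
  obtain ⟨h, hzero, hsucc⟩ := F.exists_homotopy haug hd
  cases i with
  | zero => rw [← hzero, residueMatrix_comp, residueMatrix_d, Matrix.zero_mul]
  | succ i =>
    rw [← hsucc, residueMatrix_add, residueMatrix_comp, residueMatrix_comp, residueMatrix_d,
      residueMatrix_d, Matrix.zero_mul, Matrix.mul_zero, add_zero]

theorem Hom.residueMatrix_mul_residueMatrix {F G : MinimalGradedFreeResolution I} (φ : F.Hom G)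
    (ψ : G.Hom F) (i : ℕ) : residueMatrix (ψ.app i) * residueMatrix (φ.app i) = 1 := by
  rw [← sub_eq_zero, ← residueMatrix_comp, ← residueMatrix_id, ← residueMatrix_sub]
  refine F.residueMatrix_eq_zero_of_aug_comp_eq_zero
    (θ := fun i => ψ.app i ∘ₗ φ.app i - LinearMap.id) ?_ (fun i => ?_) i
  · rw [LinearMap.comp_sub, ← LinearMap.comp_assoc, ψ.aug_comp_app, φ.aug_comp_app,
      LinearMap.comp_id, sub_self]
  · rw [LinearMap.comp_sub, LinearMap.sub_comp, ← LinearMap.comp_assoc, ψ.d_comp_app,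
      LinearMap.comp_assoc, φ.d_comp_app, LinearMap.comp_assoc, LinearMap.comp_id,
      LinearMap.id_comp]

theorem betti_le (hI : I.IsHomogeneous (homogeneousSubmodule σ K))
    (F G : MinimalGradedFreeResolution I) (i j : ℕ) : F.betti i j ≤ G.betti i j := by
  obtain ⟨φ⟩ := nonempty_hom hI F G
  obtain ⟨ψ⟩ := nonempty_hom hI G F
  exact card_filter_eq_le_of_matrix_mul_eq_one (φ.residueMatrix_mul_residueMatrix ψ i)
    (fun _ _ => (φ.app_homogeneous i).deg_eq_of_residueMatrix_ne_zero) j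

theorem betti_eq (hI : I.IsHomogeneous (homogeneousSubmodule σ K))
    (F G : MinimalGradedFreeResolution I) (i j : ℕ) : F.betti i j = G.betti i j :=
  (betti_le hI F G i j).antisymm (betti_le hI G F i j)

theorem hasProjDim_iff (hI : I.IsHomogeneous (homogeneousSubmodule σ K))
    (F : MinimalGradedFreeResolution I) {p : ℕ} :
    HasProjDim I p ↔ IsGreatest {i | ∃ j, F.betti i j ≠ 0} p := by
  refine ⟨fun h => h.2 F, fun h => ⟨⟨F⟩, fun G => ?_⟩⟩
  simpa only [betti_eq hI G F] using h

theorem hasRegularity_iff (hI : I.IsHomogeneous (homogeneousSubmodule σ K))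
    (F : MinimalGradedFreeResolution I) {r : ℤ} :
    HasRegularity I r ↔
      IsGreatest {z : ℤ | ∃ i j : ℕ, F.betti i j ≠ 0 ∧ z = (j : ℤ) - (i : ℤ)} r := by
  refine ⟨fun h => h.2 F, fun h => ⟨⟨F⟩, fun G => ?_⟩⟩
  simpa only [betti_eq hI G F] using h

end Comparison

section MappingCone

/-- The ranks of the resolution shifted by one homological degree. -/
abbrev shiftRank (F : MinimalGradedFreeResolution I) : ℕ → ℕ
  | 0 => 0
  | i + 1 => F.rank i

/-- The degrees of the resolution shifted by one homological degree and twisted by `-e`. -/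
def shiftDeg (F : MinimalGradedFreeResolution I) (e : ℕ) : ∀ i, Fin (F.shiftRank i) → ℕ
  | 0 => Fin.elim0
  | i + 1 => fun a => F.deg i a + e

/-- The differential of the resolution shifted by one homological degree, with the usual change of
sign. -/
noncomputable def shiftD (F : MinimalGradedFreeResolution I) :
    ∀ i, (Fin (F.rank i) → MvPolynomial σ K) →ₗ[MvPolynomial σ K]
      (Fin (F.shiftRank i) → MvPolynomial σ K)
  | 0 => 0
  | i + 1 => -F.d i

/-- The differential `(u, w) ↦ (d u + f w, -d w)` of the mapping cone of multiplication by `f` on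
the resolution. -/
noncomputable def coneD (F : MinimalGradedFreeResolution I) (f : MvPolynomial σ K) (i : ℕ) :
    (Fin (F.rank (i + 1) + F.shiftRank (i + 1)) → MvPolynomial σ K) →ₗ[MvPolynomial σ K]
      (Fin (F.rank i + F.shiftRank i) → MvPolynomial σ K) :=
  (finAppendLinearEquiv _ _ _).toLinearMap ∘ₗ
    ((F.d i).coprod (f • LinearMap.id)).prod (F.shiftD i ∘ₗ LinearMap.snd _ _ _) ∘ₗ
      (finAppendLinearEquiv _ _ _).symm.toLinearMap

/-- The augmentation onto `R ⧸ (I + (f))` of the mapping cone of multiplication by `f`. -/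
noncomputable def coneAug (F : MinimalGradedFreeResolution I) (f : MvPolynomial σ K) :
    (Fin (F.rank 0 + F.shiftRank 0) → MvPolynomial σ K) →ₗ[MvPolynomial σ K]
      (MvPolynomial σ K ⧸ (I ⊔ Ideal.span {f})) :=
  Submodule.factor le_sup_left ∘ₗ F.aug ∘ₗ LinearMap.fst _ _ _ ∘ₗ
    (finAppendLinearEquiv _ _ _).symm.toLinearMap

variable (F : MinimalGradedFreeResolution I) {f : MvPolynomial σ K} {e : ℕ}

theorem shiftD_d (i : ℕ) (v : Fin (F.rank (i + 1)) → MvPolynomial σ K) :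
    F.shiftD i (F.d i v) = 0 := by
  cases i with
  | zero => rfl
  | succ i => rw [shiftD, LinearMap.neg_apply, (F.exact_succ i).apply_apply_eq_zero, neg_zero]

theorem shiftD_mem_idealOfVars (i : ℕ) (v : Fin (F.rank i) → MvPolynomial σ K)
    (a : Fin (F.shiftRank i)) : F.shiftD i v a ∈ idealOfVars σ K := by
  cases i with
  | zero => exact a.elim0
  | succ i => exact neg_mem (F.minimal i v a)

theorem shiftD_homogeneous (i : ℕ) (b : Fin (F.rank i)) :
    IsHomogeneousVector (F.shiftDeg e i) (F.deg i b + e) (F.shiftD i (Pi.single b 1)) := by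
  cases i with
  | zero => exact fun a => a.elim0
  | succ i =>
    intro a m hm
    rw [← (F.d_homogeneous i b).neg a m hm]
    exact (add_assoc _ _ _).symm

theorem coneD_append (i : ℕ) (u : Fin (F.rank (i + 1)) → MvPolynomial σ K)
    (w : Fin (F.rank i) → MvPolynomial σ K) :
    F.coneD f i (Fin.append u w) = Fin.append (F.d i u + f • w) (F.shiftD i w) := by
  have h : (finAppendLinearEquiv (MvPolynomial σ K) _ _).symm (Fin.append u w) = (u, w) :=
    (finAppendLinearEquiv _ _ _).symm_apply_apply (u, w)
  rw [coneD, LinearMap.comp_apply, LinearMap.comp_apply, LinearEquiv.coe_coe, LinearEquiv.coe_coe,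
    h]
  rfl

theorem coneAug_append (u : Fin (F.rank 0) → MvPolynomial σ K)
    (w : Fin (F.shiftRank 0) → MvPolynomial σ K) :
    F.coneAug f (Fin.append u w) = Submodule.factor le_sup_left (F.aug u) := by
  have h : (finAppendLinearEquiv (MvPolynomial σ K) _ _).symm (Fin.append u w) = (u, w) :=
    (finAppendLinearEquiv _ _ _).symm_apply_apply (u, w)
  rw [coneAug, LinearMap.comp_apply, LinearMap.comp_apply, LinearMap.comp_apply,
    LinearEquiv.coe_coe, h]
  rfl

theorem coneD_homogeneous (hf : f.IsHomogeneous e) (i : ℕ) :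
    IsHomogeneousMap (Fin.append (F.deg (i + 1)) (F.shiftDeg e (i + 1)))
      (Fin.append (F.deg i) (F.shiftDeg e i)) (F.coneD f i) := by
  intro b
  refine Fin.addCases (fun b => ?_) (fun b => ?_) b
  · rw [← append_single_zero, coneD_append, smul_zero, add_zero, map_zero, Fin.append_left]
    exact (F.d_homogeneous i b).append .zero
  · rw [← append_zero_single, coneD_append, map_zero, zero_add, Fin.append_right]
    exact ((IsHomogeneousVector.single b).smul hf).append (F.shiftD_homogeneous i b)

theorem coneD_mem_idealOfVars (hf : f ∈ idealOfVars σ K) (i : ℕ)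
    (v : Fin (F.rank (i + 1) + F.shiftRank (i + 1)) → MvPolynomial σ K)
    (a : Fin (F.rank i + F.shiftRank i)) : F.coneD f i v a ∈ idealOfVars σ K := by
  obtain ⟨u, w, rfl⟩ := exists_append_eq v
  rw [coneD_append]
  refine Fin.addCases (fun a => ?_) (fun a => ?_) a
  · rw [Fin.append_left]
    exact add_mem (F.minimal i u a) (Ideal.mul_mem_right _ _ hf)
  · rw [Fin.append_right]
    exact F.shiftD_mem_idealOfVars i w a

theorem coneAug_homogeneous (b : Fin (F.rank 0 + F.shiftRank 0)) :
    ∃ p : MvPolynomial σ K, p.IsHomogeneous (Fin.append (F.deg 0) (F.shiftDeg e 0) b) ∧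
      F.coneAug f (Pi.single b 1) = Ideal.Quotient.mk _ p := by
  refine Fin.addCases (fun b => ?_) (fun b => b.elim0) b
  obtain ⟨p, hp, hpb⟩ := F.aug_homogeneous b
  refine ⟨p, by rwa [Fin.append_left], ?_⟩
  rw [← append_single_zero, coneAug_append, hpb]
  rfl

theorem coneAug_surjective : Function.Surjective (F.coneAug f) := by
  intro x
  obtain ⟨u, rfl⟩ := ((Submodule.factor_surjective le_sup_left).comp F.aug_surjective) x
  exact ⟨Fin.append u 0, F.coneAug_append u 0⟩

theorem exact_coneD_zero_coneAug : Function.Exact (F.coneD f 0) (F.coneAug f) := by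
  intro v
  obtain ⟨u, z, rfl⟩ := exists_append_eq v
  rw [coneAug_append, factor_sup_span_singleton_eq_zero_iff]
  constructor
  · rintro ⟨y, hy⟩
    obtain ⟨w, rfl⟩ := F.aug_surjective y
    obtain ⟨t, ht⟩ := (F.exact_zero (u - f • w)).1 (by rw [map_sub, map_smul, hy, sub_self])
    refine ⟨Fin.append t w, ?_⟩
    rw [coneD_append, ht, sub_add_cancel, Subsingleton.elim z]
  · rintro ⟨v, hv⟩
    obtain ⟨t, w, rfl⟩ := exists_append_eq v
    have hu : F.d 0 t + f • w = u := by
      rw [coneD_append] at hv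
      exact funext fun a => by simpa only [Fin.append_left] using congrFun hv (Fin.castAdd _ a)
    exact ⟨F.aug w, by
      rw [← hu, map_add, F.exact_zero.apply_apply_eq_zero, zero_add, map_smul]⟩

theorem mem_range_d_of_d_add_smul_eq_zero (hreg : IsSMulRegular (MvPolynomial σ K ⧸ I) f) {i : ℕ}
    {u : Fin (F.rank (i + 1)) → MvPolynomial σ K} {w : Fin (F.rank i) → MvPolynomial σ K}
    (huw : F.d i u + f • w = 0) (hw : F.shiftD i w = 0) : ∃ t, F.d i t = w := by
  cases i with
  | zero =>
    refine (F.exact_zero w).1 (hreg.right_eq_zero_of_smul ?_)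
    rw [← map_smul, ← neg_eq_of_add_eq_zero_right huw, map_neg, F.exact_zero.apply_apply_eq_zero,
      neg_zero]
  | succ i =>
    rw [shiftD, LinearMap.neg_apply, neg_eq_zero] at hw
    exact (F.exact_succ i w).1 hw

theorem exact_coneD_succ_coneD (hreg : IsSMulRegular (MvPolynomial σ K ⧸ I) f) (i : ℕ) :
    Function.Exact (F.coneD f (i + 1)) (F.coneD f i) := by
  intro v
  obtain ⟨u, w, rfl⟩ := exists_append_eq v
  constructor
  · intro hv
    rw [coneD_append, append_eq_zero_iff] at hv
    obtain ⟨t, rfl⟩ := F.mem_range_d_of_d_add_smul_eq_zero hreg hv.1 hv.2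
    obtain ⟨s, hs⟩ := (F.exact_succ i (u + f • t)).1 (by rw [map_add, map_smul, hv.1])
    refine ⟨Fin.append s (-t), ?_⟩
    rw [coneD_append, hs, smul_neg, add_neg_cancel_right, shiftD, LinearMap.neg_apply, map_neg,
      neg_neg]
  · rintro ⟨v, hv⟩
    obtain ⟨s, t, rfl⟩ := exists_append_eq v
    rw [← hv, coneD_append, coneD_append, append_eq_zero_iff, shiftD, LinearMap.neg_apply, map_neg,
      map_add, map_smul, (F.exact_succ i).apply_apply_eq_zero, zero_add, shiftD_d, smul_neg]
    exact ⟨add_neg_cancel _, neg_zero⟩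

/-- The mapping cone of multiplication by `f` on a minimal graded free resolution of `R ⧸ I`, for a
form `f` of positive degree `e` which is a nonzerodivisor on `R ⧸ I`: a minimal graded free
resolution of `R ⧸ (I + (f))`. -/
noncomputable def cone (hf : f.IsHomogeneous e) (he : e ≠ 0)
    (hreg : IsSMulRegular (MvPolynomial σ K ⧸ I) f) :
    MinimalGradedFreeResolution (I ⊔ Ideal.span {f}) where
  rank i := F.rank i + F.shiftRank i
  deg i := Fin.append (F.deg i) (F.shiftDeg e i)
  d := F.coneD f
  aug := F.coneAug f
  d_homogeneous := F.coneD_homogeneous hf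
  aug_homogeneous := F.coneAug_homogeneous
  aug_surjective := F.coneAug_surjective
  exact_zero := F.exact_coneD_zero_coneAug
  exact_succ := F.exact_coneD_succ_coneD hreg
  minimal := F.coneD_mem_idealOfVars <|
    mem_idealOfVars_iff_constantCoeff_eq_zero.2 <| hf.coeff_eq_zero (by simpa using he.symm)

theorem betti_ne_zero_iff {i j : ℕ} : F.betti i j ≠ 0 ↔ ∃ a, F.deg i a = j := by
  simp [betti, Finset.filter_eq_empty_iff]

theorem betti_cone_ne_zero_iff (hf : f.IsHomogeneous e) (he : e ≠ 0)
    (hreg : IsSMulRegular (MvPolynomial σ K ⧸ I) f) {i j : ℕ} :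
    (F.cone hf he hreg).betti i j ≠ 0 ↔
      F.betti i j ≠ 0 ∨ ∃ i' j', F.betti i' j' ≠ 0 ∧ i = i' + 1 ∧ j = j' + e := by
  simp only [betti_ne_zero_iff]
  have hsplit : (∃ a, (F.cone hf he hreg).deg i a = j) ↔
      (∃ a, F.deg i a = j) ∨ ∃ a, F.shiftDeg e i a = j := by
    constructor
    · rintro ⟨a, rfl⟩
      refine Fin.addCases (fun a => ?_) (fun a => ?_) a
      · exact .inl ⟨a, (Fin.append_left _ _ a).symm⟩
      · exact .inr ⟨a, (Fin.append_right _ _ a).symm⟩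
    · rintro (⟨a, rfl⟩ | ⟨a, rfl⟩)
      · exact ⟨Fin.castAdd _ a, Fin.append_left _ _ a⟩
      · exact ⟨Fin.natAdd _ a, Fin.append_right _ _ a⟩
  rw [hsplit]
  refine or_congr_right ?_
  cases i with
  | zero => exact ⟨fun ⟨a, _⟩ => a.elim0, fun ⟨_, _, _, h, _⟩ => absurd h (Nat.succ_ne_zero _).symm⟩
  | succ i =>
    constructor
    · rintro ⟨a, rfl⟩
      exact ⟨i, _, ⟨a, rfl⟩, rfl, rfl⟩
    · rintro ⟨_, _, ⟨a, rfl⟩, h, rfl⟩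
      obtain rfl := Nat.succ_injective h
      exact ⟨a, rfl⟩

/-- The minimal graded free resolution `0 → R → R ⧸ 0 → 0`. -/
noncomputable def ofBot : MinimalGradedFreeResolution (⊥ : Ideal (MvPolynomial σ K)) where
  rank
    | 0 => 1
    | _ + 1 => 0
  deg _ _ := 0
  d _ := 0
  aug := Submodule.mkQ _ ∘ₗ LinearMap.proj 0
  d_homogeneous _ b := b.elim0
  aug_homogeneous b := ⟨1, isHomogeneous_one _ _, by
    rw [Subsingleton.elim b 0]
    simp⟩
  aug_surjective := (Submodule.mkQ_surjective _).comp fun p => ⟨fun _ => p, rfl⟩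
  exact_zero v := by
    rw [LinearMap.comp_apply, ← LinearMap.mem_ker, Submodule.ker_mkQ, Submodule.mem_bot]
    exact ⟨fun h => ⟨0, funext fun b => by rw [Subsingleton.elim b 0]; exact h.symm⟩,
      fun ⟨_, h⟩ => congrFun h.symm 0⟩
  exact_succ i v := ⟨fun _ => ⟨0, Subsingleton.elim _ _⟩, fun _ => rfl⟩
  minimal _ _ _ := Submodule.zero_mem _

theorem betti_ofBot_ne_zero_iff {i j : ℕ} :
    (ofBot : MinimalGradedFreeResolution (⊥ : Ideal (MvPolynomial σ K))).betti i j ≠ 0 ↔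
      i = 0 ∧ j = 0 := by
  rw [betti_ne_zero_iff]
  cases i with
  | zero => exact ⟨fun ⟨_, h⟩ => ⟨rfl, h.symm⟩, fun h => ⟨(0 : Fin 1), h.2.symm⟩⟩
  | succ i => exact ⟨fun ⟨a, _⟩ => a.elim0, fun h => absurd h.1 (Nat.succ_ne_zero i)⟩

end MappingCone

end MinimalGradedFreeResolution

section RegularSequence

open MinimalGradedFreeResolution RingTheory.Sequence

attribute [local instance] MvPolynomial.gradedAlgebra

variable {σ K : Type*} [Field K] {I : Ideal (MvPolynomial σ K)} {f : MvPolynomial σ K} {e : ℕ}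

theorem isHomogeneous_sup_span_singleton (hI : I.IsHomogeneous (homogeneousSubmodule σ K))
    (hf : f.IsHomogeneous e) :
    (I ⊔ Ideal.span {f}).IsHomogeneous (homogeneousSubmodule σ K) :=
  hI.sup (Ideal.homogeneous_span _ _ fun _ h => h ▸ ⟨e, hf⟩)

theorem HasProjDim.sup_span_singleton (hI : I.IsHomogeneous (homogeneousSubmodule σ K))
    (hf : f.IsHomogeneous e) (he : e ≠ 0) (hreg : IsSMulRegular (MvPolynomial σ K ⧸ I) f)
    {p : ℕ} (h : HasProjDim I p) : HasProjDim (I ⊔ Ideal.span {f}) (p + 1) := by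
  obtain ⟨⟨F⟩, hF⟩ := h
  obtain ⟨⟨j, hj⟩, hmax⟩ := hF F
  rw [hasProjDim_iff (isHomogeneous_sup_span_singleton hI hf) (F.cone hf he hreg)]
  simp only [betti_cone_ne_zero_iff]
  refine ⟨⟨j + e, .inr ⟨p, j, hj, rfl, rfl⟩⟩, ?_⟩
  rintro _ ⟨_, hi | ⟨i, j, hi, rfl, rfl⟩⟩
  · exact (hmax ⟨_, hi⟩).trans (Nat.le_succ p)
  · exact Nat.succ_le_succ (hmax ⟨j, hi⟩)

theorem HasRegularity.sup_span_singleton (hI : I.IsHomogeneous (homogeneousSubmodule σ K))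
    (hf : f.IsHomogeneous e) (he : e ≠ 0) (hreg : IsSMulRegular (MvPolynomial σ K ⧸ I) f)
    {r : ℤ} (h : HasRegularity I r) : HasRegularity (I ⊔ Ideal.span {f}) (r + (e - 1)) := by
  obtain ⟨⟨F⟩, hF⟩ := h
  obtain ⟨⟨i, j, hij, rfl⟩, hmax⟩ := hF F
  rw [hasRegularity_iff (isHomogeneous_sup_span_singleton hI hf) (F.cone hf he hreg)]
  simp only [betti_cone_ne_zero_iff]
  refine ⟨⟨i + 1, j + e, .inr ⟨i, j, hij, rfl, rfl⟩, by push_cast; ring⟩, ?_⟩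
  rintro _ ⟨_, _, hi | ⟨i', j', hi, rfl, rfl⟩, rfl⟩
  · have := hmax ⟨_, _, hi, rfl⟩
    omega
  · have := hmax ⟨i', j', hi, rfl⟩
    push_cast
    linarith

theorem hasProjDim_bot : HasProjDim (⊥ : Ideal (MvPolynomial σ K)) 0 := by
  rw [hasProjDim_iff (Ideal.IsHomogeneous.bot _) ofBot]
  simp only [betti_ofBot_ne_zero_iff]
  exact ⟨⟨0, rfl, rfl⟩, fun _ ⟨_, hi, _⟩ => hi.le⟩

theorem hasRegularity_bot : HasRegularity (⊥ : Ideal (MvPolynomial σ K)) 0 := by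
  rw [hasRegularity_iff (Ideal.IsHomogeneous.bot _) ofBot]
  simp only [betti_ofBot_ne_zero_iff]
  refine ⟨⟨0, 0, ⟨rfl, rfl⟩, rfl⟩, ?_⟩
  rintro _ ⟨_, _, ⟨rfl, rfl⟩, rfl⟩
  rfl

variable {ι : Type*} {g : ι → MvPolynomial σ K} {d : ι → ℕ} {l : List ι}

theorem isHomogeneous_ofList_map (hg : ∀ i, (g i).IsHomogeneous (d i)) (l : List ι) :
    (Ideal.ofList (l.map g)).IsHomogeneous (homogeneousSubmodule σ K) :=
  Ideal.homogeneous_span _ _ fun _ hp => by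
    obtain ⟨i, -, rfl⟩ := List.mem_map.1 hp
    exact ⟨d i, hg i⟩

theorem isWeaklyRegular_append_singleton_iff {R : Type*} [CommRing R] (rs : List R) (r : R) :
    IsWeaklyRegular R (rs ++ [r]) ↔
      IsWeaklyRegular R rs ∧ IsSMulRegular (R ⧸ Ideal.ofList rs) r := by
  rw [isWeaklyRegular_append_iff, isWeaklyRegular_singleton_iff, smul_eq_mul, Ideal.mul_top]

theorem hasProjDim_ofList_map (hg : ∀ i, (g i).IsHomogeneous (d i)) (hd : ∀ i, d i ≠ 0)
    (hl : IsWeaklyRegular (MvPolynomial σ K) (l.map g)) :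
    HasProjDim (Ideal.ofList (l.map g)) l.length := by
  induction l using List.reverseRecOn with
  | nil => simpa using hasProjDim_bot
  | append_singleton l i ih =>
    rw [List.map_append, List.map_singleton, isWeaklyRegular_append_singleton_iff] at hl
    rw [List.map_append, List.map_singleton, Ideal.ofList_append, Ideal.ofList_singleton,
      List.length_append]
    exact (ih hl.1).sup_span_singleton (isHomogeneous_ofList_map hg l) (hg i) (hd i) hl.2

theorem hasRegularity_ofList_map (hg : ∀ i, (g i).IsHomogeneous (d i)) (hd : ∀ i, d i ≠ 0)
    (hl : IsWeaklyRegular (MvPolynomial σ K) (l.map g)) :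
    HasRegularity (Ideal.ofList (l.map g)) (l.map fun i => (d i : ℤ) - 1).sum := by
  induction l using List.reverseRecOn with
  | nil => simpa using hasRegularity_bot
  | append_singleton l i ih =>
    rw [List.map_append, List.map_singleton, isWeaklyRegular_append_singleton_iff] at hl
    rw [List.map_append, List.map_singleton, Ideal.ofList_append, Ideal.ofList_singleton,
      List.map_append, List.map_singleton, List.sum_append, List.sum_singleton]
    exact (ih hl.1).sup_span_singleton (isHomogeneous_ofList_map hg l) (hg i) (hd i) hl.2

end RegularSequence

section CoprimeMonomials

open RingTheory.Sequence

variable {σ R : Type*} [CommRing R]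

theorem isSMulRegular_monomial_of_forall_disjoint {s : Set (σ →₀ ℕ)} {m : σ →₀ ℕ}
    (h : ∀ n ∈ s, Disjoint n m) :
    IsSMulRegular (MvPolynomial σ R ⧸ Ideal.span ((fun n => monomial n (1 : R)) '' s))
      (monomial m (1 : R)) := by
  refine (isSMulRegular_quotient_iff_mem_of_smul_mem _ _).2 fun p hp => ?_
  rw [smul_eq_mul, mem_ideal_span_monomial_image] at hp
  rw [mem_ideal_span_monomial_image]
  intro k hk
  have hmk : m + k ∈ (monomial m (1 : R) * p).support := by
    rwa [mem_support_iff, coeff_monomial_mul, one_mul, ← mem_support_iff]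
  obtain ⟨n, hn, hle⟩ := hp _ hmk
  refine ⟨n, hn, fun a => ?_⟩
  have hinf : n a ⊓ m a = 0 := DFunLike.congr_fun (disjoint_iff.1 (h n hn)) a
  have := hle a
  rw [Finsupp.add_apply] at this
  grind

theorem isWeaklyRegular_map_monomial {l : List (σ →₀ ℕ)} (hl : l.Pairwise Disjoint) :
    IsWeaklyRegular (MvPolynomial σ R) (l.map fun m => monomial m (1 : R)) := by
  induction l using List.reverseRecOn with
  | nil => exact .nil _ _
  | append_singleton l m ih =>
    rw [List.pairwise_append] at hl
    rw [List.map_append, List.map_singleton, isWeaklyRegular_append_singleton_iff]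
    refine ⟨ih hl.1, ?_⟩
    have hspan : Ideal.ofList (l.map fun m => monomial m (1 : R)) =
        Ideal.span ((fun m => monomial m (1 : R)) '' {n | n ∈ l}) :=
      congrArg Ideal.span (Set.ext fun _ => List.mem_map)
    rw [hspan]
    exact isSMulRegular_monomial_of_forall_disjoint fun n hn => hl.2.2 n hn m (by simp)

end CoprimeMonomials

section PerfectMatching

variable {V : Type*} {G : SimpleGraph V} {M : G.Subgraph}

theorem two_mul_ncard_edgeSet_of_isMatching [Finite M.verts] (hM : M.IsMatching) :
    2 * M.edgeSet.ncard = M.verts.ncard := by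
  classical
  have := Fintype.ofFinite M.verts
  rw [SimpleGraph.Subgraph.isMatching_iff_forall_degree] at hM
  calc 2 * M.edgeSet.ncard = 2 * M.coe.edgeSet.ncard := by
        rw [← M.image_coe_edgeSet_coe,
          Set.ncard_image_of_injective _ (Sym2.map.injective Subtype.val_injective)]
    _ = 2 * M.coe.edgeFinset.card := by
        rw [← SimpleGraph.coe_edgeFinset, Set.ncard_coe_finset]
    _ = M.verts.ncard := by simp [← M.coe.sum_degrees_eq_twice_card_edges, hM]

theorem two_mul_matchingNumber_of_isPerfectMatching [Finite V] (hM : M.IsPerfectMatching) :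
    2 * G.matchingNumber = Nat.card V := by
  have hcard : 2 * M.edgeSet.ncard = Nat.card V := by
    rw [two_mul_ncard_edgeSet_of_isMatching hM.1, SimpleGraph.Subgraph.isSpanning_iff.1 hM.2,
      Set.ncard_univ]
  rw [← hcard]
  refine congrArg (2 * ·) (IsGreatest.csSup_eq ⟨⟨M, hM.1, rfl⟩, ?_⟩)
  rintro _ ⟨N, hN, rfl⟩
  refine le_of_mul_le_mul_left (α := ℕ) ?_ two_pos
  rw [two_mul_ncard_edgeSet_of_isMatching hN, hcard]
  exact Set.ncard_le_card _

end PerfectMatching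

section Whiskered

variable {V : Type*}

/-- The perfect matching of the whiskered graph which consists of the whiskers. -/
def whiskerMatching (G : SimpleGraph V) : G.whiskered.Subgraph where
  verts := Set.univ
  Adj x y := x.swap = y
  adj_sub := by
    rintro (u | u) _ rfl
    · exact Eq.refl u
    · exact Eq.refl u
  edge_vert _ := trivial
  symm := ⟨fun x _ h => h ▸ x.swap_swap⟩

theorem isPerfectMatching_whiskerMatching (G : SimpleGraph V) :
    (whiskerMatching G).IsPerfectMatching :=
  SimpleGraph.Subgraph.isPerfectMatching_iff.2 fun x => ⟨x.swap, rfl, fun _ => Eq.symm⟩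

theorem matchingNumber_whiskered [Finite V] (G : SimpleGraph V) :
    G.whiskered.matchingNumber = Nat.card V := by
  have h := two_mul_matchingNumber_of_isPerfectMatching (isPerfectMatching_whiskerMatching G)
  rw [Nat.card_sum] at h
  omega

variable [Finite V] (K : Type*) [Field K] (G : SimpleGraph V)

theorem closedNbhdMonomial_whiskered_inr (v : V) :
    G.whiskered.closedNbhdMonomial K (Sum.inr v) = X (Sum.inl v) * X (Sum.inr v) := by
  classical
  have h : (insert (Sum.inr v) (G.whiskered.neighborSet (Sum.inr v))).toFinite.toFinset =
      {Sum.inl v, Sum.inr v} := by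
    ext (x | x) <;> simp [SimpleGraph.whiskered, eq_comm]
  rw [SimpleGraph.closedNbhdMonomial, h, Finset.prod_pair Sum.inl_ne_inr]

theorem mul_dvd_closedNbhdMonomial_whiskered_inl (v : V) :
    X (Sum.inl v) * X (Sum.inr v) ∣ G.whiskered.closedNbhdMonomial K (Sum.inl v) := by
  classical
  rw [← Finset.prod_pair Sum.inl_ne_inr]
  refine Finset.prod_dvd_prod_of_subset _ _ _ fun x hx => ?_
  rw [Set.Finite.mem_toFinset]
  obtain rfl | rfl := by simpa using hx
  · exact Set.mem_insert _ _
  · exact Set.mem_insert_of_mem _ (Eq.refl v)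

theorem closedNbhdIdeal_whiskered :
    G.whiskered.closedNbhdIdeal K = Ideal.span (Set.range fun v : V =>
      (X (Sum.inl v) * X (Sum.inr v) : MvPolynomial (V ⊕ V) K)) := by
  refine le_antisymm (Ideal.span_le.2 ?_) (Ideal.span_mono ?_)
  · rintro _ ⟨v | v, rfl⟩
    · exact Ideal.mem_of_dvd _ (mul_dvd_closedNbhdMonomial_whiskered_inl K G v)
        (Ideal.subset_span ⟨v, rfl⟩)
    · exact Ideal.subset_span ⟨v, (closedNbhdMonomial_whiskered_inr K G v).symm⟩
  · rintro _ ⟨v, rfl⟩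
    exact ⟨Sum.inr v, closedNbhdMonomial_whiskered_inr K G v⟩

end Whiskered

section WhiskerMonomials

variable {V : Type*}

/-- The exponent of the monomial `x_v y_v`. -/
noncomputable def whiskerExponent (v : V) : V ⊕ V →₀ ℕ :=
  Finsupp.single (Sum.inl v) 1 + Finsupp.single (Sum.inr v) 1

theorem monomial_whiskerExponent {R : Type*} [CommSemiring R] (v : V) :
    monomial (whiskerExponent v) (1 : R) = X (Sum.inl v) * X (Sum.inr v) := by
  rw [X, X, monomial_mul, mul_one, whiskerExponent]

theorem degree_whiskerExponent (v : V) : (whiskerExponent v).degree = 2 := by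
  simp [whiskerExponent]

theorem disjoint_whiskerExponent {v w : V} (h : v ≠ w) :
    Disjoint (whiskerExponent v) (whiskerExponent w) := by
  classical
  rw [disjoint_iff, bot_eq_zero]
  ext (u | u)
  all_goals
    obtain rfl | hu := eq_or_ne u v
    · simp [whiskerExponent, h]
    · simp [whiskerExponent, hu.symm]

end WhiskerMonomials

theorem mainTheorem7 {V : Type*} [Fintype V] (K : Type*) [Field K] (G : SimpleGraph V) :
    HasRegularity (G.whiskered.closedNbhdIdeal K) (G.whiskered.matchingNumber : ℤ) ∧
    HasProjDim (G.whiskered.closedNbhdIdeal K) G.whiskered.matchingNumber ∧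
    G.whiskered.closedNbhdIdeal K =
      Ideal.span (Set.range fun v : V =>
        (X (Sum.inl v) * X (Sum.inr v) : MvPolynomial (V ⊕ V) K)) ∧
    G.whiskered.matchingNumber = Fintype.card V := by
  have hcard : G.whiskered.matchingNumber = Fintype.card V := by
    rw [matchingNumber_whiskered, Nat.card_eq_fintype_card]
  have hNI : Ideal.ofList ((Finset.univ : Finset V).toList.map
      fun v => monomial (whiskerExponent v) (1 : K)) = G.whiskered.closedNbhdIdeal K := by
    rw [closedNbhdIdeal_whiskered]
    exact congrArg Ideal.span (by ext; simp [monomial_whiskerExponent])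
  have hreg : RingTheory.Sequence.IsWeaklyRegular (MvPolynomial (V ⊕ V) K)
      ((Finset.univ : Finset V).toList.map fun v => monomial (whiskerExponent v) (1 : K)) := by
    rw [← Function.comp_def (fun m => monomial m (1 : K)), ← List.map_map]
    exact isWeaklyRegular_map_monomial <|
      List.pairwise_map.2 ((Finset.nodup_toList _).imp disjoint_whiskerExponent)
  have hdeg (v : V) : (monomial (whiskerExponent v) (1 : K)).IsHomogeneous 2 :=
    isHomogeneous_monomial _ (degree_whiskerExponent v)
  refine ⟨?_, ?_, closedNbhdIdeal_whiskered K G, hcard⟩ <;> rw [hcard, ← hNI]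
  · simpa using hasRegularity_ofList_map hdeg (fun _ => two_ne_zero) hreg
  · simpa using hasProjDim_ofList_map hdeg (fun _ => two_ne_zero) hreg
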